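/- Let $P$ be a probability distribution on a finite alphabet $\mathcal V$, let $W(y|x)$ be a channel with countable input and output alphabets $\mathcal X,\mathcal Y$, and let $Q,Q'$ be probability distributions on $\mathcal X$. Write $P^k(\boldsymbol v)=\prod_{j=1}^k P(v_j)$ and $W^n(\boldsymbol y|\boldsymbol x)=\prod_{j=1}^n W(y_j|x_j)$. For $\rho\in[0,1]$ put $$E_s(\rho,P)=\log\Bigl(\sum_v P(v)^{\frac1{1+\rho}}\Bigr)^{1+\rho},\qquad E_0(\rho,W,Q)=-\log\sum_y\Bigl(\sum_x Q(x)W(y|x)^{\frac1{1+\rho}}\Bigr)^{1+\rho},$$ $$E_0(\rho,W,\{Q,Q'\})=\max\{E_0(\rho,W,Q),E_0(\rho,W,Q')\},$$ and let $$\bar E_0(\rho,W,\{Q,Q'\})=\sup\bigl\{\lambda E_0(\rho_1,W,\{Q,Q'\})+(1-\lambda)E_0(\rho_2,W,\{Q,Q'\}) : \rho_1,\rho_2,\lambda\in[0,1],\ \lambda\rho_1+(1-\lambda)\rho_2=\rho\bigr\}$$ be its concave hull in $\rho$. A code of length $n$ for the messages $\boldsymbol v\in\mathcal V^k$ is a map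 $\boldsymbol v\mapsto\boldsymbol x(\boldsymbol v)\in\mathcal X^n$, with the MAP decoder $\hat{\boldsymbol v}=\arg\max_{\boldsymbol v}P^k(\boldsymbol v)W^n(\boldsymbol y|\boldsymbol x(\boldsymbol v))$ (ties broken arbitrarily) and error probability $\epsilon=\Pr\{\hat{\boldsymbol V}\ne\boldsymbol V\}$. For a partition of $\mathcal V^k$ into two classes with associated distributions $Q_1,Q_2$, the random code draws the codewords $\boldsymbol x(\boldsymbol v)$ independently, with distribution $\prod_{j=1}^n Q_i(x_j)$ if $\boldsymbol v$ is in class $i$. Let $t$ be a real number. Then the maximum $$E=\max_{\rho\in[0,1]}\bigl\{\bar E_0(\rho,W,\{Q,Q'\})-t\,E_s(\rho,P)\bigr\}$$ is attained, and $E$ is an achievable exponent at transmission rate $t$: for every sequence of positive integers $n=n_k$ with $k/n_k\to t$ there are codes of length $n_k$ for the messages of length $k$ with $\epsilon\le e^{-nE+o(n)}$. Moreover, there are $\gamma\in[0,1]$ and $Q_1,Q_2\in\{Q,Q'\}$ (not depending on $k$ or on the sequence $n_k$) such that the two-class partition $$\mathcal A_k^{(1)}(\gamma)=\{\boldsymbol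 v: P^k(\boldsymbol v)<\gamma^k\},\qquad \mathcal A_k^{(2)}(\gamma)=\{\boldsymbol v: P^k(\boldsymbol v)\ge\gamma^k\}$$ with associated distributions $Q_1,Q_2$ achieves $E$: for every such sequence $n_k$, the error probability of the random code, averaged over the code, satisfies $\bar\epsilon\le e^{-nE+o(n)}$. -/

import Mathlib

open scoped ENNReal
open Filter Topology

namespace JSCC

noncomputable section

/-! Discrete alphabets: `V` (source, finite), `X` (channel input), `Y` (channel output).
A memoryless source is a `P : PMF V`, a memoryless channel is a `W : X → PMF Y`
(`W x y` is the probability of output `y` given input `x`).  Probabilities and their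
sums are taken in `ℝ≥0∞`. -/

/-- The product law `∏ⱼ p(aⱼ)` of a sequence of length `m`. -/
def seqProb {A : Type*} (p : PMF A) {m : ℕ} (a : Fin m → A) : ℝ≥0∞ :=
  ∏ j, p (a j)

/-- The memoryless channel law `∏ⱼ W(yⱼ | xⱼ)` on blocks of length `n`. -/
def chanProb {X Y : Type*} (W : X → PMF Y) {n : ℕ} (x : Fin n → X) (y : Fin n → Y) : ℝ≥0∞ :=
  ∏ j, W (x j) (y j)

/-- A codebook (encoder): it maps each source message of length `k` to a codeword of
length `n`. -/
abbrev Codebook (V X : Type*) (k n : ℕ) : Type _ := (Fin k → V) → (Fin n → X)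

/-- A decoder: it maps each channel output block to a source message. -/
abbrev Decoder (V Y : Type*) (k n : ℕ) : Type _ := (Fin n → Y) → (Fin k → V)

/-- `φ` is a maximum a posteriori decoder for the codebook `c`: for every output `y`,
`φ y` maximizes `P(v) W(y | x(v))` over all messages `v` (ties broken arbitrarily). -/
def IsMAPDecoder {V X Y : Type*} (P : PMF V) (W : X → PMF Y) {k n : ℕ}
    (c : Codebook V X k n) (φ : Decoder V Y k n) : Prop :=
  ∀ (y : Fin n → Y) (v : Fin k → V),
    seqProb P v * chanProb W (c v) y ≤ seqProb P (φ y) * chanProb W (c (φ y)) y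

open Classical in
/-- The average error probability `Pr{V̂ ≠ V}` of the codebook `c` with decoder `φ`. -/
def errorProb {V X Y : Type*} [Fintype V] (P : PMF V) (W : X → PMF Y) {k n : ℕ}
    (c : Codebook V X k n) (φ : Decoder V Y k n) : ℝ≥0∞ :=
  ∑ v : Fin k → V, seqProb P v * ∑' y : Fin n → Y, if φ y = v then 0 else chanProb W (c v) y

/-- The probability of drawing the codebook `c` when the codewords are independent and the
codeword of message `v` has the product distribution of `Q (cls v)`.  Here `cls` is a
partition of the messages into classes labelled by `ι` (class `i` is `{v | cls v = i}`) and
`Q i` is the channel-input distribution associated with class `i`. -/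
def codebookProb {V X ι : Type*} [Fintype V] {k n : ℕ} (cls : (Fin k → V) → ι) (Q : ι → PMF X)
    (c : Codebook V X k n) : ℝ≥0∞ :=
  ∏ v : Fin k → V, seqProb (Q (cls v)) (c v)

/-- The error probability averaged over the random codebook of `codebookProb`, where `dec`
gives the decoder used with each realization of the codebook. -/
def ensembleErrorProb {V X Y ι : Type*} [Fintype V] (P : PMF V) (W : X → PMF Y) {k n : ℕ}
    (cls : (Fin k → V) → ι) (Q : ι → PMF X) (dec : Codebook V X k n → Decoder V Y k n) : ℝ≥0∞ :=
  ∑' c : Codebook V X k n, codebookProb cls Q c * errorProb P W c (dec c)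

/-- `n 0, n 1, …` is a sequence of (positive) block lengths of transmission rate `t`,
that is `k / n k → t`. -/
def HasRate (n : ℕ → ℕ) (t : ℝ) : Prop :=
  (∀ k, 0 < n k) ∧ Tendsto (fun k : ℕ => (k : ℝ) / (n k : ℝ)) atTop (𝓝 t)

/-- The exponent `E` is achievable at transmission rate `t`: for all block lengths of rate
`t` there are codes with MAP decoding whose error probability is at most
`exp (-n E + o(n))`. -/
def IsAchievable {V X Y : Type*} [Fintype V] (P : PMF V) (W : X → PMF Y) (t E : ℝ) : Prop :=
  ∀ n : ℕ → ℕ, HasRate n t →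
    ∃ (c : (k : ℕ) → Codebook V X k (n k)) (φ : (k : ℕ) → Decoder V Y k (n k)) (δ : ℕ → ℝ),
      (∀ k, IsMAPDecoder P W (c k) (φ k)) ∧
      Tendsto (fun k => δ k / (n k : ℝ)) atTop (𝓝 0) ∧
      ∀ k, errorProb P W (c k) (φ k) ≤ ENNReal.ofReal (Real.exp (-(n k : ℝ) * E + δ k))

/-- The sequence of partitions `cls k` with the associated distributions `Q` achieves the
exponent `E` at transmission rate `t`: for all block lengths of rate `t`, the random
codebook generated from the partition and from `Q`, with MAP decoding, has average error
probability at most `exp (-n E + o(n))`. -/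
def PartitionAchieves {V X Y ι : Type*} [Fintype V] (P : PMF V) (W : X → PMF Y) (t E : ℝ)
    (cls : (k : ℕ) → (Fin k → V) → ι) (Q : ι → PMF X) : Prop :=
  ∀ n : ℕ → ℕ, HasRate n t →
    ∃ δ : ℕ → ℝ, Tendsto (fun k => δ k / (n k : ℝ)) atTop (𝓝 0) ∧
      ∀ (k : ℕ) (dec : Codebook V X k (n k) → Decoder V Y k (n k)),
        (∀ c, IsMAPDecoder P W c (dec c)) →
        ensembleErrorProb P W (cls k) Q dec ≤ ENNReal.ofReal (Real.exp (-(n k : ℝ) * E + δ k))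

open Classical in
/-- The partition into two classes with threshold `γ ^ k`:
class `0` is `{v | P^k(v) < γ ^ k}` and class `1` is `{v | P^k(v) ≥ γ ^ k}`. -/
def thresholdClass {V : Type*} (P : PMF V) (γ : ℝ) (k : ℕ) (v : Fin k → V) : Fin 2 :=
  if seqProb P v < ENNReal.ofReal (γ ^ k) then 0 else 1

/-- Gallager's source function `E_s(ρ, P) = log (∑ᵥ P(v)^(1/(1+ρ)))^(1+ρ)`. -/
def Es {V : Type*} [Fintype V] (ρ : ℝ) (P : PMF V) : ℝ :=
  Real.log (((∑ v, P v ^ (1 / (1 + ρ))) ^ (1 + ρ)).toReal)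

/-- Gallager's channel function
`E₀(ρ, W, Q) = - log ∑_y (∑_x Q(x) W(y|x)^(1/(1+ρ)))^(1+ρ)`. -/
def E0 {X Y : Type*} (ρ : ℝ) (W : X → PMF Y) (Q : PMF X) : ℝ :=
  -Real.log ((∑' y, (∑' x, Q x * W x y ^ (1 / (1 + ρ))) ^ (1 + ρ)).toReal)

/-- `E₀(ρ, W, 𝒬) = max_{Q ∈ 𝒬} E₀(ρ, W, Q)` for a set `𝒬` of input distributions. -/
def E0Set {X Y : Type*} (ρ : ℝ) (W : X → PMF Y) (𝒬 : Set (PMF X)) : ℝ :=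
  sSup ((fun Q => E0 ρ W Q) '' 𝒬)

/-- The concave hull of `ρ ↦ E₀(ρ, W, 𝒬)` on `[0, 1]`: the supremum of
`l * E₀(ρ₁, W, 𝒬) + (1 - l) * E₀(ρ₂, W, 𝒬)` over `ρ₁, ρ₂, l ∈ [0, 1]` with
`l * ρ₁ + (1 - l) * ρ₂ = ρ`. -/
def barE0 {X Y : Type*} (ρ : ℝ) (W : X → PMF Y) (𝒬 : Set (PMF X)) : ℝ :=
  sSup {z | ∃ ρ₁ ∈ Set.Icc (0 : ℝ) 1, ∃ ρ₂ ∈ Set.Icc (0 : ℝ) 1, ∃ l ∈ Set.Icc (0 : ℝ) 1,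
    l * ρ₁ + (1 - l) * ρ₂ = ρ ∧ z = l * E0Set ρ₁ W 𝒬 + (1 - l) * E0Set ρ₂ W 𝒬}

end

end JSCC

namespace JSCC

/-! Give each class its own Gallager parameter ρ_i and bound the MAP error of the random code by a
union bound tilted class by class. The cross terms between classes separate, so up to a constant the
error is at most the sum over the classes of (∑_{v in class i} P^k(v)^{1/(1+ρ_i)})^{1+ρ_i} e^{-n
E₀(ρ_i, W, Q_i)} (`ensembleErrorProb_le`).

Restricting the source sum to one side of the threshold γ = e^ℓ replaces E_s(ρ_i) by the value at
ρ_i of the line through (-1, ℓ) and (σ, E_s(σ)), for ρ_i ≤ σ below the threshold and ρ_i ≥ σ above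
it. If ℓ is the mean of log P under the tilted law at σ, this line is tangent to E_s at σ
(`hasDerivAt_Es`).

Now choose the two points and the weight of the concave hull jointly optimal, and let σ be their
mixture. Stationarity in the weight says that E₀ minus t times the tangent takes the same value at
both points, namely E (`exists_tangent_of_max`). Hence both classes have exponent E. -/

/-! ### Sums over product spaces and marginals of the random codebook. -/

theorem tsum_fin_pi_prod {α : Type*} : ∀ {n : ℕ} (f : Fin n → α → ℝ≥0∞),
    ∑' c : Fin n → α, ∏ i, f i (c i) = ∏ i, ∑' a, f i a
  | 0, f => by simp
  | n + 1, f => by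
    rw [← (Fin.consEquiv fun _ => α).tsum_eq, Fin.prod_univ_succ,
      ← tsum_fin_pi_prod fun i => f i.succ]
    simp only [Fin.consEquiv, Equiv.coe_fn_mk, Fin.prod_univ_succ, Fin.cons_zero, Fin.cons_succ]
    rw [ENNReal.tsum_prod (f := fun (a : α) (c : Fin n → α) => f 0 a * ∏ i, f i.succ (c i))]
    simp_rw [ENNReal.tsum_mul_left, ENNReal.tsum_mul_right]

theorem tsum_pi_prod {ι α : Type*} [Fintype ι] (f : ι → α → ℝ≥0∞) :
    ∑' c : ι → α, ∏ i, f i (c i) = ∏ i, ∑' a, f i a := by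
  let e := Fintype.equivFin ι
  rw [← (Equiv.arrowCongr e.symm (Equiv.refl α)).tsum_eq, ← e.symm.prod_comp,
    ← tsum_fin_pi_prod]
  refine tsum_congr fun c => ?_
  rw [← e.symm.prod_comp]
  simp

section Marginals

variable {M X : Type*} [Fintype M]

/-- Pairwise independence of the codewords, the only independence that the union bound needs: all
other coordinates sum to 1. -/
theorem tsum_prod_mul_pair {q : M → X → ℝ≥0∞} (hq : ∀ u, ∑' x, q u x = 1) {v v' : M}
    (h : v ≠ v') (f g : X → ℝ≥0∞) :
    ∑' c : M → X, (∏ u, q u (c u)) * (f (c v) * g (c v'))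
      = (∑' x, q v x * f x) * ∑' x, q v' x * g x := by
  classical
  have key : ∀ c : M → X, (∏ u, q u (c u)) * (f (c v) * g (c v'))
      = ∏ u, q u (c u) * ((if u = v then f (c u) else 1) * if u = v' then g (c u) else 1) := by
    intro c
    simp only [Finset.prod_mul_distrib, Finset.prod_ite_eq', Finset.mem_univ, if_true]
  simp_rw [key]
  rw [tsum_pi_prod fun u x => q u x * ((if u = v then f x else 1) * if u = v' then g x else 1),
    Fintype.prod_eq_mul v v' h]
  · simp [h, h.symm]
  · rintro u ⟨h1, h2⟩
    simp [h1, h2, hq]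

theorem tsum_prod_mul_single {q : M → X → ℝ≥0∞} (hq : ∀ u, ∑' x, q u x = 1) (v : M)
    (f : X → ℝ≥0∞) :
    ∑' c : M → X, (∏ u, q u (c u)) * f (c v) = ∑' x, q v x * f x := by
  classical
  have key : ∀ c : M → X, (∏ u, q u (c u)) * f (c v)
      = ∏ u, q u (c u) * (if u = v then f (c u) else 1) := by
    intro c
    simp only [Finset.prod_mul_distrib, Finset.prod_ite_eq', Finset.mem_univ, if_true]
  simp_rw [key]
  rw [tsum_pi_prod fun u x => q u x * (if u = v then f x else 1), Fintype.prod_eq_single v]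
  · simp
  · rintro u h1
    simp [h1, hq]

end Marginals

/-! ### Random coding bound at a fixed channel output. -/

theorem rpow_mul_rpow_one_sub_le_add (a b : ℝ≥0∞) {s : ℝ} (h0 : 0 ≤ s) (h1 : s ≤ 1) :
    a ^ s * b ^ (1 - s) ≤ a + b := by
  calc a ^ s * b ^ (1 - s) ≤ (max a b) ^ s * (max a b) ^ (1 - s) :=
        mul_le_mul' (ENNReal.rpow_le_rpow (le_max_left _ _) h0)
          (ENNReal.rpow_le_rpow (le_max_right _ _) (by linarith))
    _ = max a b := by
        rw [← ENNReal.rpow_add_of_nonneg _ _ h0 (by linarith)]; simp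
    _ ≤ a + b := max_le le_self_add le_add_self

/-- Uses min(1, u) ≤ u^r for r in [0, 1]. The choice r = (1 - s)/s' leaves the power 1 - s'r = s of
`a`; since s, s' ≥ 1/2 (that is, ρ ≤ 1), r does not exceed 1. -/
theorem mul_min_one_le_rpow {a Z : ℝ≥0∞} {s s' : ℝ} (hs : 1 / 2 ≤ s) (hs1 : s ≤ 1)
    (hs' : 1 / 2 ≤ s') (ha : a ≠ ⊤) :
    a * min 1 (Z * (a ^ s')⁻¹) ≤ a ^ s * Z ^ ((1 - s) / s') := by
  rcases eq_or_ne a 0 with rfl | ha0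
  · simp
  have hr0 : 0 ≤ (1 - s) / s' := div_nonneg (by linarith) (by linarith)
  have hr1 : (1 - s) / s' ≤ 1 := by rw [div_le_one (by linarith)]; linarith
  have hmin : min 1 (Z * (a ^ s')⁻¹) ≤ (Z * (a ^ s')⁻¹) ^ ((1 - s) / s') := by
    rcases le_total 1 (Z * (a ^ s')⁻¹) with h | h
    · exact (min_le_left _ _).trans (by simpa using ENNReal.rpow_le_rpow h hr0)
    · refine (min_le_right _ _).trans ?_
      simpa using ENNReal.rpow_le_rpow_of_exponent_ge h hr1
  refine (mul_le_mul_right hmin a).trans (le_of_eq ?_)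
  rw [ENNReal.mul_rpow_of_nonneg _ _ hr0, ← ENNReal.rpow_neg, ← ENNReal.rpow_mul, mul_left_comm,
    mul_comm]
  congr 1
  nth_rw 1 [← ENNReal.rpow_one a]
  rw [← ENNReal.rpow_add _ _ ha0 ha]
  congr 1
  field_simp
  ring

section RandomCoding

variable {M X ι : Type*} [Fintype M]

open Classical in
/-- The class sums `∑_{v ∈ class i} p(v)^s ∑_x q_v(x) w(x)^s` of the random coding bound. -/
noncomputable def classSum (p : M → ℝ≥0∞) (q : M → X → ℝ≥0∞) (w : X → ℝ≥0∞) (cls : M → ι)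
    (s : ι → ℝ) (i : ι) : ℝ≥0∞ :=
  ∑ v, if cls v = i then p v ^ s i * ∑' x, q v x * w x ^ s i else 0

variable {p : M → ℝ≥0∞} {q : M → X → ℝ≥0∞} {w : X → ℝ≥0∞} {φ : (M → X) → M}

open Classical in
/-- Probability that message `v` is sent as `x` and confused with a message of class `j`. -/
theorem tsum_confusion_le (cls : M → ι) {s : ι → ℝ} (hs : ∀ i, 0 ≤ s i)
    (hq : ∀ u, ∑' x, q u x = 1) (hp : ∀ v, p v ≠ ⊤) (hw : ∀ x, w x ≠ ⊤)
    (hφ : ∀ c v, p v * w (c v) ≤ p (φ c) * w (c (φ c))) (v : M) (x : X) (j : ι)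
    (ha : p v * w x ≠ 0) :
    ∑' c : M → X, (∏ u, q u (c u)) *
        (if c v = x ∧ φ c ≠ v ∧ cls (φ c) = j then 1 else 0)
      ≤ q v x * min 1 (classSum p q w cls s j * ((p v * w x) ^ s j)⁻¹) := by
  rw [mul_min, mul_one]
  have hone : ∑' x', q v x' * (if x' = x then 1 else 0) = q v x := by
    rw [tsum_eq_single x] <;> simp +contextual
  refine le_min ?_ ?_
  · rw [← hone, ← tsum_prod_mul_single hq v fun x' => if x' = x then 1 else 0]
    refine ENNReal.tsum_le_tsum fun c => mul_le_mul_right ?_ _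
    split_ifs <;> simp_all
  · set a := p v * w x with ha_def
    have hat : a ^ s j ≠ ⊤ :=
      ENNReal.rpow_ne_top_of_nonneg (hs j) (ENNReal.mul_ne_top (hp v) (hw x))
    have ha0 : a ^ s j ≠ 0 := by
      exact (ENNReal.rpow_pos (pos_iff_ne_zero.2 ha) (ENNReal.mul_ne_top (hp v) (hw x))).ne'
    -- Union bound over the decoded message v'. If v' wins, its metric is at least `a`, so the
    -- tilted ratio (p v' * w (c v') / a)^(s j) is at least 1.
    have hpt : ∀ c : M → X, (if c v = x ∧ φ c ≠ v ∧ cls (φ c) = j then (1 : ℝ≥0∞) else 0)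
        ≤ ∑ v', if v' ≠ v ∧ cls v' = j then
            (if c v = x then 1 else 0) * ((p v' * w (c v')) ^ s j * (a ^ s j)⁻¹) else 0 := by
      intro c
      by_cases h : c v = x ∧ φ c ≠ v ∧ cls (φ c) = j
      · obtain ⟨h1, h2, h3⟩ := h
        rw [if_pos ⟨h1, h2, h3⟩]
        refine le_trans ?_ (Finset.single_le_sum (fun _ _ => zero_le) (Finset.mem_univ (φ c)))
        rw [if_pos ⟨h2, h3⟩, if_pos h1, one_mul, ← ENNReal.mul_inv_cancel ha0 hat]
        refine mul_le_mul_left (ENNReal.rpow_le_rpow ?_ (hs j)) _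
        have := hφ c v
        rwa [h1] at this
      · rw [if_neg h]; exact zero_le
    calc _ ≤ ∑' c : M → X, (∏ u, q u (c u)) * ∑ v', (if v' ≠ v ∧ cls v' = j then
            (if c v = x then 1 else 0) * ((p v' * w (c v')) ^ s j * (a ^ s j)⁻¹) else 0) :=
          ENNReal.tsum_le_tsum fun c => mul_le_mul_right (hpt c) _
      _ = ∑ v', ∑' c : M → X, (∏ u, q u (c u)) * (if v' ≠ v ∧ cls v' = j then
            (if c v = x then 1 else 0) * ((p v' * w (c v')) ^ s j * (a ^ s j)⁻¹) else 0) := by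
          simp_rw [Finset.mul_sum]
          exact Summable.tsum_finsetSum fun _ _ => ENNReal.summable
      _ ≤ ∑ v', q v x * ((if cls v' = j then p v' ^ s j * ∑' x, q v' x * w x ^ s j else 0) *
            (a ^ s j)⁻¹) := by
          refine Finset.sum_le_sum fun v' _ => ?_
          by_cases h : v' ≠ v ∧ cls v' = j
          · simp only [if_pos h, if_pos h.2]
            rw [tsum_prod_mul_pair hq h.1.symm (fun x' => if x' = x then 1 else 0)
              fun x' => (p v' * w x') ^ s j * (a ^ s j)⁻¹, hone]
            refine mul_le_mul_right ?_ _
            rw [← ENNReal.tsum_mul_left, ← ENNReal.tsum_mul_right]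
            refine ENNReal.tsum_le_tsum fun x' => le_of_eq ?_
            rw [ENNReal.mul_rpow_of_nonneg _ _ (hs j)]
            ring
          · simp [if_neg h]
      _ = _ := by rw [← Finset.mul_sum, ← Finset.sum_mul]; rfl

-- The tilt of `p v * w x` is that of the class of v, whatever the class j of the competitor, so
-- that summing over v rebuilds the class sums.
open Classical in
theorem tsum_error_message_le [Fintype ι] (cls : M → ι) {s : ι → ℝ} (hs : ∀ i, 1 / 2 ≤ s i)
    (hs1 : ∀ i, s i ≤ 1)
    (hq : ∀ u, ∑' x, q u x = 1) (hp : ∀ v, p v ≠ ⊤) (hw : ∀ x, w x ≠ ⊤)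
    (hφ : ∀ c v, p v * w (c v) ≤ p (φ c) * w (c (φ c))) (v : M) :
    ∑' c : M → X, (∏ u, q u (c u)) * (p v * if φ c = v then 0 else w (c v))
      ≤ ∑ j, (p v ^ s (cls v) * ∑' x, q v x * w x ^ s (cls v)) *
          classSum p q w cls s j ^ ((1 - s (cls v)) / s j) := by
  -- Only the term with x the transmitted codeword and j the class of the decoded message is
  -- nonzero.
  have hpt : ∀ c : M → X, (∏ u, q u (c u)) * (p v * if φ c = v then 0 else w (c v))
      = ∑' x, ∑ j, (p v * w x) * ((∏ u, q u (c u)) *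
        (if c v = x ∧ φ c ≠ v ∧ cls (φ c) = j then 1 else 0)) := by
    intro c
    rw [tsum_eq_single (c v), Fintype.sum_eq_single (cls (φ c))]
    · by_cases h : φ c = v <;> simp [h]
      ring
    · intro j hj
      simp [hj.symm]
    · intro x hx
      simp [hx.symm]
  simp_rw [hpt]
  rw [ENNReal.tsum_comm]
  calc _ = ∑' x, ∑ j, (p v * w x) * ∑' c : M → X, ((∏ u, q u (c u)) *
        (if c v = x ∧ φ c ≠ v ∧ cls (φ c) = j then 1 else 0)) := by
        refine tsum_congr fun x => ?_
        rw [Summable.tsum_finsetSum fun _ _ => ENNReal.summable]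
        simp_rw [ENNReal.tsum_mul_left]
    _ ≤ ∑' x, ∑ j, q v x * ((p v * w x) ^ s (cls v) *
          classSum p q w cls s j ^ ((1 - s (cls v)) / s j)) := by
        refine ENNReal.tsum_le_tsum fun x => Finset.sum_le_sum fun j _ => ?_
        rcases eq_or_ne (p v * w x) 0 with ha | ha
        · rw [ha, zero_mul]; exact zero_le
        refine (mul_le_mul_right (tsum_confusion_le cls (fun i => by linarith [hs i]) hq hp hw hφ
          v x j ha) _).trans ?_
        rw [mul_left_comm]
        exact mul_le_mul_right (mul_min_one_le_rpow (hs _) (hs1 _) (hs j)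
          (ENNReal.mul_ne_top (hp v) (hw x))) _
    _ = _ := by
        rw [Summable.tsum_finsetSum fun _ _ => ENNReal.summable]
        refine Finset.sum_congr rfl fun j _ => ?_
        rw [← ENNReal.tsum_mul_left, ← ENNReal.tsum_mul_right]
        refine tsum_congr fun x => ?_
        rw [ENNReal.mul_rpow_of_nonneg _ _ (by linarith [hs (cls v)])]
        ring

open Classical in
/-- Random coding bound for a fixed channel output. -/
theorem tsum_error_le [Fintype ι] (cls : M → ι) {s : ι → ℝ} (hs : ∀ i, 1 / 2 ≤ s i)
    (hs1 : ∀ i, s i ≤ 1)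
    (hq : ∀ u, ∑' x, q u x = 1) (hp : ∀ v, p v ≠ ⊤) (hw : ∀ x, w x ≠ ⊤)
    (hφ : ∀ c v, p v * w (c v) ≤ p (φ c) * w (c (φ c))) :
    ∑' c : M → X, (∏ u, q u (c u)) * ∑ v, p v * (if φ c = v then 0 else w (c v))
      ≤ ∑ i, ∑ j, (classSum p q w cls s i ^ (1 / s i) + classSum p q w cls s j ^ (1 / s j)) := by
  simp_rw [Finset.mul_sum]
  rw [Summable.tsum_finsetSum fun _ _ => ENNReal.summable]
  calc _ ≤ ∑ v, ∑ j, (p v ^ s (cls v) * ∑' x, q v x * w x ^ s (cls v)) *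
          classSum p q w cls s j ^ ((1 - s (cls v)) / s j) :=
        Finset.sum_le_sum fun v _ => tsum_error_message_le cls hs hs1 hq hp hw hφ v
    _ = ∑ i, ∑ j, classSum p q w cls s i * classSum p q w cls s j ^ ((1 - s i) / s j) := by
        simp_rw [← Finset.mul_sum]
        conv_rhs => enter [2, i]; rw [classSum, Finset.sum_mul]
        rw [Finset.sum_comm]
        refine Finset.sum_congr rfl fun v _ => ?_
        refine ((Fintype.sum_eq_single (cls v) fun i hi => ?_).trans ?_).symm
        · rw [if_neg hi.symm, zero_mul]
        · rw [if_pos rfl]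
    _ ≤ _ := by
        -- With A_i the class sum to the power 1/s_i, the cross term is A_i^{s_i} A_j^{1-s_i}, a
        -- geometric mean.
        refine Finset.sum_le_sum fun i _ => Finset.sum_le_sum fun j _ => ?_
        have hi := hs i
        have hj := hs j
        refine le_trans (le_of_eq ?_) (rpow_mul_rpow_one_sub_le_add _ _ (by linarith) (hs1 i))
        rw [← ENNReal.rpow_mul, ← ENNReal.rpow_mul, one_div_mul_cancel (by linarith),
          ENNReal.rpow_one, one_div_mul_eq_div]

end RandomCoding

/-! ### Error bound for the class-based ensemble, and derandomization. -/

/-- The sum inside Gallager's function `E₀(ρ, W, Q)`. -/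
noncomputable def chanSum {X Y : Type*} (ρ : ℝ) (W : X → PMF Y) (Q : PMF X) : ℝ≥0∞ :=
  ∑' y, (∑' x, Q x * W x y ^ (1 / (1 + ρ))) ^ (1 + ρ)

open Classical in
/-- The source sum of Gallager's function `E_s`, restricted to the messages of class `i`. -/
noncomputable def classSourceSum {V ι : Type*} [Fintype V] (ρ : ℝ) (P : PMF V) {k : ℕ}
    (cls : (Fin k → V) → ι) (i : ι) : ℝ≥0∞ :=
  (∑ v, if cls v = i then seqProb P v ^ (1 / (1 + ρ)) else 0) ^ (1 + ρ)

theorem seqProb_ne_top {A : Type*} (p : PMF A) {m : ℕ} (a : Fin m → A) : seqProb p a ≠ ⊤ :=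
  ENNReal.prod_ne_top fun _ _ => p.apply_ne_top _

theorem chanProb_ne_top {X Y : Type*} (W : X → PMF Y) {n : ℕ} (x : Fin n → X) (y : Fin n → Y) :
    chanProb W x y ≠ ⊤ :=
  ENNReal.prod_ne_top fun _ _ => (W _).apply_ne_top _

theorem tsum_seqProb {A : Type*} (p : PMF A) (m : ℕ) : ∑' a : Fin m → A, seqProb p a = 1 := by
  simp only [seqProb]
  rw [tsum_pi_prod fun (_ : Fin m) a => p a]
  simp

theorem tsum_codebookProb {V X ι : Type*} [Fintype V] {k n : ℕ} (cls : (Fin k → V) → ι)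
    (Q : ι → PMF X) : ∑' c : Codebook V X k n, codebookProb cls Q c = 1 := by
  simp only [codebookProb]
  rw [tsum_pi_prod fun (v : Fin k → V) x => seqProb (Q (cls v)) x]
  simp [tsum_seqProb]

theorem tsum_seqProb_mul_chanProb_rpow {X Y : Type*} (W : X → PMF Y) (Q : PMF X) {n : ℕ}
    (y : Fin n → Y) {s : ℝ} (hs : 0 ≤ s) :
    ∑' x : Fin n → X, seqProb Q x * chanProb W x y ^ s = ∏ j, ∑' x, Q x * W x (y j) ^ s := by
  rw [← tsum_pi_prod fun j x => Q x * W x (y j) ^ s]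
  refine tsum_congr fun x => ?_
  rw [seqProb, chanProb, ← ENNReal.prod_rpow_of_nonneg hs, Finset.prod_mul_distrib]

/-- The inner sum over codewords depends on the message only through its class, so source and
channel factors separate, and the channel factor is a product over the letters of y. -/
theorem classSum_rpow {V X Y ι : Type*} [Fintype V] (P : PMF V) (W : X → PMF Y) {k n : ℕ}
    (cls : (Fin k → V) → ι) (Q : ι → PMF X) {ρ : ι → ℝ} (hρ : ∀ i, 0 ≤ ρ i) (i : ι)
    (y : Fin n → Y) :
    classSum (seqProb P) (fun v => seqProb (Q (cls v))) (fun x => chanProb W x y) cls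
        (fun i => 1 / (1 + ρ i)) i ^ (1 + ρ i)
      = classSourceSum (ρ i) P cls i *
        ∏ j, (∑' x, Q i x * W x (y j) ^ (1 / (1 + ρ i))) ^ (1 + ρ i) := by
  have hi := hρ i
  have h0 : 0 ≤ 1 + ρ i := by linarith
  rw [ENNReal.prod_rpow_of_nonneg h0, classSourceSum, ← ENNReal.mul_rpow_of_nonneg _ _ h0,
    classSum, Finset.sum_mul]
  congr 1
  refine Finset.sum_congr rfl fun v _ => ?_
  split_ifs with h
  · rw [h, tsum_seqProb_mul_chanProb_rpow _ _ _ (by positivity)]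
  · rw [zero_mul]

/-- Gallager-type bound for random coding with message classes. -/
theorem ensembleErrorProb_le {V X Y ι : Type*} [Fintype V] [Fintype ι] (P : PMF V)
    (W : X → PMF Y) {k n : ℕ} (cls : (Fin k → V) → ι) (Q : ι → PMF X)
    (dec : Codebook V X k n → Decoder V Y k n) (hdec : ∀ c, IsMAPDecoder P W c (dec c))
    {ρ : ι → ℝ} (hρ : ∀ i, ρ i ∈ Set.Icc (0 : ℝ) 1) :
    ensembleErrorProb P W cls Q dec
      ≤ 2 * Fintype.card ι * ∑ i, classSourceSum (ρ i) P cls i * chanSum (ρ i) W (Q i) ^ n := by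
  classical
  have hsum : ∀ i, ∑' y : Fin n → Y, classSum (seqProb P) (fun v => seqProb (Q (cls v)))
      (fun x => chanProb W x y) cls (fun i => 1 / (1 + ρ i)) i ^ (1 + ρ i)
        = classSourceSum (ρ i) P cls i * chanSum (ρ i) W (Q i) ^ n := by
    intro i
    simp_rw [classSum_rpow P W cls Q (fun i => (hρ i).1)]
    rw [ENNReal.tsum_mul_left,
      tsum_pi_prod fun (_ : Fin n) y => (∑' x, Q i x * W x y ^ (1 / (1 + ρ i))) ^ (1 + ρ i)]
    simp [chanSum]
  have hswap : ensembleErrorProb P W cls Q dec = ∑' y : Fin n → Y, ∑' c : Codebook V X k n,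
      (∏ v, seqProb (Q (cls v)) (c v)) *
        ∑ v, seqProb P v * (if dec c y = v then 0 else chanProb W (c v) y) := by
    rw [ENNReal.tsum_comm]
    refine tsum_congr fun c => ?_
    rw [ENNReal.tsum_mul_left, Summable.tsum_finsetSum fun _ _ => ENNReal.summable]
    simp_rw [ENNReal.tsum_mul_left]
    rfl
  rw [hswap]
  calc _ ≤ ∑' y : Fin n → Y, ∑ i, ∑ j,
        (classSum (seqProb P) (fun v => seqProb (Q (cls v))) (fun x => chanProb W x y) cls
          (fun i => 1 / (1 + ρ i)) i ^ (1 + ρ i) +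
        classSum (seqProb P) (fun v => seqProb (Q (cls v))) (fun x => chanProb W x y) cls
          (fun i => 1 / (1 + ρ i)) j ^ (1 + ρ j)) := by
        refine ENNReal.tsum_le_tsum fun y => ?_
        have := tsum_error_le (p := seqProb P) (q := fun v => seqProb (Q (cls v)))
          (w := fun x => chanProb W x y) (φ := fun c => dec c y) cls
          (s := fun i => 1 / (1 + ρ i))
          (fun i => one_div_le_one_div_of_le (by linarith [(hρ i).1]) (by linarith [(hρ i).2]))
          (fun i => by
            rw [div_le_one (by linarith [(hρ i).1])]
            linarith [(hρ i).1])
          (fun v => tsum_seqProb _ _) (seqProb_ne_top P) (fun x => chanProb_ne_top W x y)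
          (fun c v => hdec c y v)
        simp only [one_div_one_div] at this
        convert this
    _ = ∑ i, ∑ j, (classSourceSum (ρ i) P cls i * chanSum (ρ i) W (Q i) ^ n +
          classSourceSum (ρ j) P cls j * chanSum (ρ j) W (Q j) ^ n) := by
        rw [Summable.tsum_finsetSum fun _ _ => ENNReal.summable]
        refine Finset.sum_congr rfl fun i _ => ?_
        rw [Summable.tsum_finsetSum fun _ _ => ENNReal.summable]
        refine Finset.sum_congr rfl fun j _ => ?_
        rw [ENNReal.tsum_add, hsum, hsum]
    _ = _ := by
        -- Each class term occurs in both summands, once per value of the other index: hence the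
        -- factor 2 |ι|.
        simp only [Finset.sum_add_distrib, Finset.sum_const, Finset.card_univ, nsmul_eq_mul]
        rw [← Finset.mul_sum]
        ring

/-- Some codebook is at least as good as the average one. -/
theorem exists_errorProb_le_ensembleErrorProb {V X Y ι : Type*} [Fintype V] (P : PMF V)
    (W : X → PMF Y) {k n : ℕ} (cls : (Fin k → V) → ι) (Q : ι → PMF X)
    (dec : Codebook V X k n → Decoder V Y k n) :
    ∃ c, errorProb P W c (dec c) ≤ ensembleErrorProb P W cls Q dec := by
  by_contra! h
  have hne : ensembleErrorProb P W cls Q dec ≠ ⊤ := by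
    obtain ⟨v⟩ := P.support_nonempty.to_subtype.map fun v => v.1
    obtain ⟨x⟩ := (Q (cls fun _ => v)).support_nonempty.to_subtype.map fun x => x.1
    exact (h fun _ _ => x).ne_top
  have h1 := tsum_codebookProb (n := n) cls Q
  obtain ⟨c, hc⟩ : ∃ c : Codebook V X k n, codebookProb cls Q c ≠ 0 := by
    by_contra! h0
    simp [h0] at h1
  have hct : codebookProb cls Q c ≠ ⊤ :=
    ((ENNReal.le_tsum c).trans_eq h1).trans_lt ENNReal.one_lt_top |>.ne
  have hlt := ENNReal.tsum_lt_tsum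
    (f := fun c => codebookProb cls Q c * ensembleErrorProb P W cls Q dec)
    (g := fun c => codebookProb cls Q c * errorProb P W c (dec c)) (i := c)
    (by rw [ENNReal.tsum_mul_right, h1, one_mul]; exact hne)
    (fun c => mul_le_mul_right (h c).le _)
    ((ENNReal.mul_lt_mul_iff_right hc hct).2 (h c))
  rw [ENNReal.tsum_mul_right, h1, one_mul] at hlt
  exact hlt.ne rfl

theorem exists_isMAPDecoder {V X Y : Type*} [Fintype V] (P : PMF V) (W : X → PMF Y) {k n : ℕ}
    (c : Codebook V X k n) : ∃ φ : Decoder V Y k n, IsMAPDecoder P W c φ := by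
  have : Nonempty V := P.support_nonempty.to_subtype.map fun v => v.1
  have h := fun y : Fin n → Y =>
    Finite.exists_max fun v : Fin k → V => seqProb P v * chanProb W (c v) y
  choose φ hφ using h
  exact ⟨φ, hφ⟩

/-! ### Bounds and continuity for the channel function E₀. -/

section Channel

variable {X Y : Type*} {ρ : ℝ} (W : X → PMF Y) (Q : PMF X)

/-- The power mean of exponent `1 / (1 + ρ)` is at most the arithmetic mean. -/
theorem rpow_mean_le_mean (hρ : 0 ≤ ρ) (w : X → ℝ≥0∞) :
    (∑' x, Q x * w x ^ (1 / (1 + ρ))) ^ (1 + ρ) ≤ ∑' x, Q x * w x := by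
  have h1 : 0 < 1 + ρ := by linarith
  have h : ∑' x, Q x * w x ^ (1 / (1 + ρ)) ≤ (∑' x, Q x * w x) ^ (1 + ρ)⁻¹ := by
    rw [ENNReal.tsum_eq_iSup_sum]
    refine iSup_le fun t => ?_
    refine (ENNReal.inner_le_weight_mul_Lp_of_nonneg t (p := 1 + ρ) (by linarith) _ _).trans ?_
    have hone : (∑ x ∈ t, Q x) ^ (1 - (1 + ρ)⁻¹) ≤ 1 := by
      refine ENNReal.rpow_le_one ((ENNReal.sum_le_tsum t).trans_eq Q.tsum_coe) ?_
      rw [sub_nonneg]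
      exact inv_le_one_of_one_le₀ (by linarith)
    calc _ ≤ 1 * (∑ x ∈ t, Q x * w x) ^ (1 + ρ)⁻¹ := by
          refine mul_le_mul' hone (le_of_eq ?_)
          simp_rw [← ENNReal.rpow_mul, one_div_mul_cancel h1.ne', ENNReal.rpow_one]
      _ ≤ _ := by
          rw [one_mul]
          exact ENNReal.rpow_le_rpow (ENNReal.sum_le_tsum t) (by positivity)
  refine (ENNReal.rpow_le_rpow h h1.le).trans_eq ?_
  rw [← ENNReal.rpow_mul, inv_mul_cancel₀ h1.ne', ENNReal.rpow_one]

theorem tsum_mean_eq_one : ∑' y, ∑' x, Q x * W x y = 1 := by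
  rw [ENNReal.tsum_comm]
  simp_rw [ENNReal.tsum_mul_left, PMF.tsum_coe, mul_one]
  exact Q.tsum_coe

theorem chanSum_le_one (hρ : 0 ≤ ρ) : chanSum ρ W Q ≤ 1 :=
  (ENNReal.tsum_le_tsum fun y => rpow_mean_le_mean Q hρ fun x => W x y).trans_eq
    (tsum_mean_eq_one W Q)

theorem chanSum_pos (hρ : 0 ≤ ρ) : 0 < chanSum ρ W Q := by
  obtain ⟨x, hx⟩ := Q.support_nonempty
  obtain ⟨y, hy⟩ := (W x).support_nonempty
  rw [PMF.mem_support_iff] at hx hy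
  have h1 : 0 < 1 + ρ := by linarith
  refine lt_of_lt_of_le ?_ (ENNReal.le_tsum y)
  refine ENNReal.rpow_pos_of_nonneg (lt_of_lt_of_le ?_ (ENNReal.le_tsum x)) h1.le
  exact ENNReal.mul_pos hx (ENNReal.rpow_pos (pos_iff_ne_zero.2 hy) ((W x).apply_ne_top y)).ne'

/-- The sum lies in (0, 1], so neither `toReal` nor `Real.log` in `E0` takes a default value. -/
theorem chanSum_eq_ofReal_exp (hρ : 0 ≤ ρ) :
    chanSum ρ W Q = ENNReal.ofReal (Real.exp (-E0 ρ W Q)) := by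
  have ht : chanSum ρ W Q ≠ ⊤ := ((chanSum_le_one W Q hρ).trans_lt ENNReal.one_lt_top).ne
  rw [E0, neg_neg]
  change _ = ENNReal.ofReal (Real.exp (Real.log (chanSum ρ W Q).toReal))
  rw [Real.exp_log (ENNReal.toReal_pos (chanSum_pos W Q hρ).ne' ht), ENNReal.ofReal_toReal ht]

theorem continuousOn_rpow_one_div (a : ℝ) :
    ContinuousOn (fun ρ : ℝ => a ^ (1 / (1 + ρ))) (Set.Ici 0) := by
  have hs : ContinuousOn (fun ρ : ℝ => 1 / (1 + ρ)) (Set.Ici 0) :=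
    continuousOn_const.div (by fun_prop) fun ρ (hρ : 0 ≤ ρ) => by positivity
  refine continuousOn_const.rpow hs fun ρ (hρ : 0 ≤ ρ) => Or.inr (by positivity)

theorem toReal_mean (hρ : 0 ≤ ρ) (y : Y) :
    (∑' x, Q x * W x y ^ (1 / (1 + ρ))).toReal
      = ∑' x, (Q x).toReal * (W x y).toReal ^ (1 / (1 + ρ)) := by
  rw [ENNReal.tsum_toReal_eq fun x => ENNReal.mul_ne_top (Q.apply_ne_top x)
    (ENNReal.rpow_ne_top_of_nonneg (by positivity) ((W x).apply_ne_top y))]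
  simp_rw [ENNReal.toReal_mul, ENNReal.toReal_rpow]

theorem continuousOn_mean (y : Y) :
    ContinuousOn (fun ρ : ℝ => (∑' x, Q x * W x y ^ (1 / (1 + ρ))).toReal) (Set.Ici 0) := by
  refine ContinuousOn.congr ?_ fun ρ hρ => toReal_mean W Q hρ y
  refine continuousOn_tsum (u := fun x => (Q x).toReal)
    (fun x => continuousOn_const.mul (continuousOn_rpow_one_div _))
    (ENNReal.summable_toReal (by rw [Q.tsum_coe]; exact ENNReal.one_ne_top)) ?_
  rintro x ρ (hρ : 0 ≤ ρ)
  rw [Real.norm_of_nonneg (by positivity)]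
  refine mul_le_of_le_one_right ENNReal.toReal_nonneg
    (Real.rpow_le_one ENNReal.toReal_nonneg ?_ (by positivity))
  exact ENNReal.toReal_le_of_le_ofReal zero_le_one (by simpa using (W x).coe_le_one y)

theorem mean_ne_top (y : Y) : ∑' x, Q x * W x y ≠ ⊤ :=
  ((ENNReal.le_tsum y).trans_eq (tsum_mean_eq_one W Q)).trans_lt ENNReal.one_lt_top |>.ne

/-- Weierstrass test: each term is dominated, uniformly in ρ, by the output probability ∑_x Q(x)
W(y|x), and these sum to 1. -/
theorem continuousOn_chanSum :
    ContinuousOn (fun ρ : ℝ => (chanSum ρ W Q).toReal) (Set.Ici 0) := by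
  have hle : ∀ ρ : ℝ, 0 ≤ ρ → ∀ y, (∑' x, Q x * W x y ^ (1 / (1 + ρ))) ^ (1 + ρ)
      ≤ ∑' x, Q x * W x y := fun ρ hρ y => rpow_mean_le_mean Q hρ fun x => W x y
  refine ContinuousOn.congr (f := fun ρ : ℝ =>
    ∑' y, (∑' x, Q x * W x y ^ (1 / (1 + ρ))).toReal ^ (1 + ρ)) ?_ fun ρ (hρ : 0 ≤ ρ) => ?_
  · refine continuousOn_tsum (u := fun y => (∑' x, Q x * W x y).toReal)
      (fun y => (continuousOn_mean W Q y).rpow (by fun_prop) fun ρ (hρ : 0 ≤ ρ) =>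
        Or.inr (by positivity))
      (ENNReal.summable_toReal (by rw [tsum_mean_eq_one]; exact ENNReal.one_ne_top)) ?_
    rintro y ρ (hρ : 0 ≤ ρ)
    rw [Real.norm_of_nonneg (by positivity), ENNReal.toReal_rpow]
    exact ENNReal.toReal_mono (mean_ne_top W Q y) (hle ρ hρ y)
  · simp only [chanSum]
    rw [ENNReal.tsum_toReal_eq fun y => ne_top_of_le_ne_top (mean_ne_top W Q y) (hle ρ hρ y)]
    simp_rw [ENNReal.toReal_rpow]

theorem continuousOn_E0 : ContinuousOn (fun ρ : ℝ => E0 ρ W Q) (Set.Ici 0) :=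
  ((continuousOn_chanSum W Q).log fun _ hρ =>
    (ENNReal.toReal_pos (chanSum_pos W Q hρ).ne'
      ((chanSum_le_one W Q hρ).trans_lt ENNReal.one_lt_top).ne).ne').neg

theorem E0Set_pair (ρ : ℝ) (Q' : PMF X) :
    E0Set ρ W {Q, Q'} = max (E0 ρ W Q) (E0 ρ W Q') := by
  rw [E0Set, Set.image_pair, csSup_pair]

theorem continuousOn_E0Set_pair (Q' : PMF X) :
    ContinuousOn (fun ρ : ℝ => E0Set ρ W {Q, Q'}) (Set.Ici 0) := by
  simp_rw [E0Set_pair]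
  exact ContinuousOn.sup (continuousOn_E0 W Q) (continuousOn_E0 W Q')

theorem exists_E0_eq_E0Set_pair (ρ : ℝ) (Q' : PMF X) :
    ∃ R ∈ ({Q, Q'} : Set (PMF X)), E0 ρ W R = E0Set ρ W {Q, Q'} := by
  rw [E0Set_pair]
  rcases max_choice (E0 ρ W Q) (E0 ρ W Q') with h | h
  · exact ⟨Q, by simp, h.symm⟩
  · exact ⟨Q', by simp, h.symm⟩

end Channel

/-! ### The source function E_s, its tangents, and source sums restricted by the threshold. -/

section Source

variable {V : Type*} [Fintype V] (P : PMF V) {ρ σ : ℝ}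

/-- The sum `∑ᵥ P(v)^(1/(1+ρ))` as a real number. -/
noncomputable def srcSum (ρ : ℝ) : ℝ := ∑ v, (P v).toReal ^ (1 / (1 + ρ))

/-- The mean of `log P` under the tilted distribution proportional to `P^(1/(1+ρ))`. -/
noncomputable def tiltedLogMean (ρ : ℝ) : ℝ :=
  (∑ v, (P v).toReal ^ (1 / (1 + ρ)) * Real.log (P v).toReal) / srcSum P ρ

theorem srcSum_pos (ρ : ℝ) : 0 < srcSum P ρ := by
  obtain ⟨v, hv⟩ := P.support_nonempty
  rw [PMF.mem_support_iff] at hv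
  exact Finset.sum_pos' (fun _ _ => by positivity) ⟨v, Finset.mem_univ v,
    Real.rpow_pos_of_pos (ENNReal.toReal_pos hv (P.apply_ne_top v)) _⟩

theorem sum_rpow_eq_ofReal_srcSum (hρ : -1 < ρ) :
    ∑ v, P v ^ (1 / (1 + ρ)) = ENNReal.ofReal (srcSum P ρ) := by
  have h1 : 0 < 1 + ρ := by linarith
  rw [srcSum, ENNReal.ofReal_sum_of_nonneg fun _ _ => by positivity]
  refine Finset.sum_congr rfl fun v _ => ?_
  rw [ENNReal.toReal_rpow, ENNReal.ofReal_toReal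
    (ENNReal.rpow_ne_top_of_nonneg (by positivity) (P.apply_ne_top v))]

theorem Es_eq (hρ : -1 < ρ) : Es ρ P = (1 + ρ) * Real.log (srcSum P ρ) := by
  rw [Es, sum_rpow_eq_ofReal_srcSum P hρ, ← ENNReal.toReal_rpow,
    ENNReal.toReal_ofReal (srcSum_pos P ρ).le, Real.log_rpow (srcSum_pos P ρ)]

theorem sum_rpow_eq_ofReal_exp (hρ : -1 < ρ) :
    ∑ v, P v ^ (1 / (1 + ρ)) = ENNReal.ofReal (Real.exp (Es ρ P / (1 + ρ))) := by
  have h1 : 1 + ρ ≠ 0 := by linarith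
  rw [sum_rpow_eq_ofReal_srcSum P hρ, Es_eq P hρ, mul_div_cancel_left₀ _ h1,
    Real.exp_log (srcSum_pos P ρ)]

theorem hasDerivAt_rpow_one_div {a : ℝ} (ha : 0 ≤ a) (hρ : -1 < ρ) :
    HasDerivAt (fun r : ℝ => a ^ (1 / (1 + r)))
      (a ^ (1 / (1 + ρ)) * Real.log a * (-1 / (1 + ρ) ^ 2)) ρ := by
  have h1 : 0 < 1 + ρ := by linarith
  rcases ha.eq_or_lt with rfl | ha
  -- For a letter of probability zero the power vanishes identically near ρ, and so does the claimed
  -- derivative.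
  · have : (fun r : ℝ => (0 : ℝ) ^ (1 / (1 + r))) =ᶠ[𝓝 ρ] fun _ => 0 := by
      filter_upwards [lt_mem_nhds hρ] with r hr
      exact Real.zero_rpow (one_div_ne_zero (by linarith))
    simpa using (hasDerivAt_const ρ (0 : ℝ)).congr_of_eventuallyEq this
  · have hs : HasDerivAt (fun r : ℝ => 1 / (1 + r)) (-1 / (1 + ρ) ^ 2) ρ := by
      simpa using ((hasDerivAt_id ρ).const_add 1).fun_inv h1.ne'
    convert hs.const_rpow ha using 1
    ring

/-- The derivative is the slope from (-1, `tiltedLogMean P ρ`) to (ρ, E_s(ρ)): the tangent at ρ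
meets the abscissa -1 at the tilted mean of log P. This dictates the threshold. -/
theorem hasDerivAt_Es (hρ : -1 < ρ) :
    HasDerivAt (fun r => Es r P) ((Es ρ P - tiltedLogMean P ρ) / (1 + ρ)) ρ := by
  have h1 : 0 < 1 + ρ := by linarith
  have hS : HasDerivAt (fun r => srcSum P r)
      (∑ v, (P v).toReal ^ (1 / (1 + ρ)) * Real.log (P v).toReal * (-1 / (1 + ρ) ^ 2)) ρ :=
    HasDerivAt.fun_sum fun v _ => hasDerivAt_rpow_one_div ENNReal.toReal_nonneg hρ
  have hE := ((hasDerivAt_id ρ).const_add 1).mul (hS.log (srcSum_pos P ρ).ne')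
  have heq : (fun r => Es r P) =ᶠ[𝓝 ρ] fun r => (1 + r) * Real.log (srcSum P r) := by
    filter_upwards [lt_mem_nhds hρ] with r hr
    exact Es_eq P hr
  refine (hE.congr_of_eventuallyEq heq).congr_deriv ?_
  have := (srcSum_pos P ρ).ne'
  rw [← Finset.sum_mul, Es_eq P hρ, tiltedLogMean]
  simp only [id]
  field_simp
  ring

theorem tiltedLogMean_nonpos (ρ : ℝ) : tiltedLogMean P ρ ≤ 0 := by
  refine div_nonpos_of_nonpos_of_nonneg (Finset.sum_nonpos fun v _ => ?_) (srcSum_pos P ρ).le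
  refine mul_nonpos_of_nonneg_of_nonpos (by positivity) (Real.log_nonpos ENNReal.toReal_nonneg ?_)
  exact ENNReal.toReal_le_of_le_ofReal zero_le_one (by simpa using P.coe_le_one v)

theorem sum_seqProb_rpow {k : ℕ} {s : ℝ} (hs : 0 ≤ s) :
    ∑ v : Fin k → V, seqProb P v ^ s = (∑ v, P v ^ s) ^ k := by
  have := tsum_pi_prod fun (_ : Fin k) v => P v ^ s
  simp only [tsum_fintype, Finset.prod_const, Finset.card_univ, Fintype.card_fin] at this
  rw [← this]
  exact Finset.sum_congr rfl fun v _ => (ENNReal.prod_rpow_of_nonneg hs).symm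

theorem ofReal_exp_rpow (x s : ℝ) :
    ENNReal.ofReal (Real.exp x) ^ s = ENNReal.ofReal (Real.exp (x * s)) := by
  rw [ENNReal.ofReal_rpow_of_pos (Real.exp_pos x), ← Real.exp_mul]

theorem ofReal_exp_mul (x y : ℝ) :
    ENNReal.ofReal (Real.exp x) * ENNReal.ofReal (Real.exp y)
      = ENNReal.ofReal (Real.exp (x + y)) := by
  rw [Real.exp_add, ENNReal.ofReal_mul (Real.exp_pos x).le]

theorem ofReal_exp_pow (x : ℝ) (k : ℕ) :
    ENNReal.ofReal (Real.exp x) ^ k = ENNReal.ofReal (Real.exp (k * x)) := by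
  rw [Real.exp_nat_mul, ENNReal.ofReal_pow (Real.exp_pos x).le]

/-- The source sum of a class is bounded through the chord from `(-1, ℓ)` to `(σ, E_s(σ))`. -/
theorem classSourceSum_le {ι : Type*} {k : ℕ} (cls : (Fin k → V) → ι) (i : ι)
    (hρ : -1 < ρ) (hσ : -1 < σ) (ℓ : ℝ)
    (h : ∀ v, cls v = i → seqProb P v ^ (1 / (1 + ρ)) ≤ seqProb P v ^ (1 / (1 + σ)) *
      ENNReal.ofReal (Real.exp (k * ℓ)) ^ (1 / (1 + ρ) - 1 / (1 + σ))) :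
    classSourceSum ρ P cls i
      ≤ ENNReal.ofReal (Real.exp (k * (((1 + ρ) * Es σ P + (σ - ρ) * ℓ) / (1 + σ)))) := by
  classical
  have h1 : 0 < 1 + ρ := by linarith
  have h2 : 0 < 1 + σ := by linarith
  calc classSourceSum ρ P cls i
      ≤ (∑ v : Fin k → V, seqProb P v ^ (1 / (1 + σ)) *
          ENNReal.ofReal (Real.exp (k * ℓ)) ^ (1 / (1 + ρ) - 1 / (1 + σ))) ^ (1 + ρ) := by
        refine ENNReal.rpow_le_rpow (Finset.sum_le_sum fun v _ => ?_) h1.le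
        split_ifs with hv
        · exact h v hv
        · exact zero_le
    _ = _ := by
        rw [← Finset.sum_mul, sum_seqProb_rpow P (by positivity), sum_rpow_eq_ofReal_exp P hσ,
          ofReal_exp_pow, ofReal_exp_rpow, ofReal_exp_mul, ofReal_exp_rpow]
        -- The exponent is affine in ρ because (1+ρ)(1/(1+ρ) - 1/(1+σ)) = (σ-ρ)/(1+σ).
        congr 2
        field_simp
        ring

theorem ofReal_exp_pow_eq (ℓ : ℝ) (k : ℕ) :
    ENNReal.ofReal (Real.exp ℓ ^ k) = ENNReal.ofReal (Real.exp (k * ℓ)) := by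
  rw [← Real.exp_nat_mul]

/-- For ρ ≤ σ the surplus exponent 1/(1+ρ) - 1/(1+σ) is nonnegative, so the upper bound on P^k(v) in
this class controls the surplus factor. -/
theorem classSourceSum_threshold_zero_le {k : ℕ} (hρ : -1 < ρ) (h : ρ ≤ σ) (ℓ : ℝ) :
    classSourceSum ρ P (thresholdClass P (Real.exp ℓ) k) 0
      ≤ ENNReal.ofReal (Real.exp (k * (((1 + ρ) * Es σ P + (σ - ρ) * ℓ) / (1 + σ)))) := by
  have h1 : 0 < 1 + ρ := by linarith
  have h2 : 0 < 1 + σ := by linarith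
  refine classSourceSum_le P _ 0 hρ (by linarith) ℓ fun v hv => ?_
  have hlt : seqProb P v < ENNReal.ofReal (Real.exp (k * ℓ)) := by
    rw [← ofReal_exp_pow_eq]
    by_contra hcon
    simp [thresholdClass, hcon] at hv
  have hs : 0 ≤ 1 / (1 + ρ) - 1 / (1 + σ) :=
    sub_nonneg.2 (one_div_le_one_div_of_le h1 (by linarith))
  calc seqProb P v ^ (1 / (1 + ρ))
      = seqProb P v ^ (1 / (1 + σ)) * seqProb P v ^ (1 / (1 + ρ) - 1 / (1 + σ)) := by
        rw [← ENNReal.rpow_add_of_nonneg _ _ (by positivity) hs, add_sub_cancel]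
    _ ≤ _ := mul_le_mul_right (ENNReal.rpow_le_rpow hlt.le hs) _

/-- For ρ ≥ σ the surplus exponent is nonpositive, and the lower bound on P^k(v) takes over. -/
theorem classSourceSum_threshold_one_le {k : ℕ} (hσ : -1 < σ) (h : σ ≤ ρ) (ℓ : ℝ) :
    classSourceSum ρ P (thresholdClass P (Real.exp ℓ) k) 1
      ≤ ENNReal.ofReal (Real.exp (k * (((1 + ρ) * Es σ P + (σ - ρ) * ℓ) / (1 + σ)))) := by
  have h1 : 0 < 1 + ρ := by linarith
  have h2 : 0 < 1 + σ := by linarith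
  refine classSourceSum_le P _ 1 (by linarith) hσ ℓ fun v hv => ?_
  have hle : ENNReal.ofReal (Real.exp (k * ℓ)) ≤ seqProb P v := by
    rw [← ofReal_exp_pow_eq]
    by_contra hcon
    simp [thresholdClass, not_le.1 hcon] at hv
  have hpos : seqProb P v ≠ 0 :=
    (lt_of_lt_of_le (ENNReal.ofReal_pos.2 (Real.exp_pos _)) hle).ne'
  have hs : 0 ≤ 1 / (1 + σ) - 1 / (1 + ρ) :=
    sub_nonneg.2 (one_div_le_one_div_of_le h2 (by linarith))
  calc seqProb P v ^ (1 / (1 + ρ))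
      = seqProb P v ^ (1 / (1 + σ)) * seqProb P v ^ (1 / (1 + ρ) - 1 / (1 + σ)) := by
        rw [← ENNReal.rpow_add _ _ hpos (seqProb_ne_top P v), add_sub_cancel]
    _ ≤ _ := by
        refine mul_le_mul_right ?_ _
        rw [← neg_sub, ENNReal.rpow_neg, ENNReal.rpow_neg, ENNReal.inv_le_inv]
        exact ENNReal.rpow_le_rpow hle hs

end Source

/-! ### Block lengths of a given rate and o(n) terms. -/

section Rate

variable {n : ℕ → ℕ} {t : ℝ}

/-- Eventually k/n < |t| + 1, so n ≥ k/(|t| + 1); this covers t = 0. -/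
theorem HasRate.tendsto_atTop (h : HasRate n t) : Tendsto (fun k => (n k : ℝ)) atTop atTop := by
  have hpos : 0 < |t| + 1 := by positivity
  refine tendsto_atTop_mono' atTop ?_ (tendsto_natCast_atTop_atTop.atTop_div_const hpos)
  filter_upwards [h.2.eventually_lt_const (lt_of_le_of_lt (le_abs_self t) (lt_add_one |t|))]
    with k hk
  have hn : (0 : ℝ) < n k := Nat.cast_pos.2 (h.1 k)
  rw [div_le_iff₀ hpos, mul_comm]
  exact ((div_lt_iff₀ hn).1 hk).le

theorem HasRate.tendsto_slack (h : HasRate n t) (a C : ℝ) :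
    Tendsto (fun k : ℕ => (a + C * |(k : ℝ) - t * n k|) / (n k : ℝ)) atTop (𝓝 0) := by
  have h1 : Tendsto (fun k => a / (n k : ℝ)) atTop (𝓝 0) := h.tendsto_atTop.const_div_atTop a
  have h2 : Tendsto (fun k : ℕ => C * |(k : ℝ) / n k - t|) atTop (𝓝 0) := by
    simpa using ((h.2.sub_const t).abs.const_mul C)
  have h3 := h1.add h2
  rw [add_zero] at h3
  refine h3.congr fun k => ?_
  have hn : (0 : ℝ) < n k := Nat.cast_pos.2 (h.1 k)
  rw [add_div, mul_div_assoc, ← abs_of_pos hn, ← abs_div, abs_of_pos hn, sub_div,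
    mul_div_cancel_right₀ _ hn.ne']

end Rate

/-! ### From source bounds for each class to achievable exponents. -/

section Achievability

variable {V X Y : Type*} [Fintype V] {P : PMF V} {W : X → PMF Y} {t E : ℝ}

theorem partitionAchieves_of_classSourceSum_le {cls : (k : ℕ) → (Fin k → V) → Fin 2}
    {Q : Fin 2 → PMF X} {ρ : Fin 2 → ℝ} (hρ : ∀ i, ρ i ∈ Set.Icc (0 : ℝ) 1) (r : Fin 2 → ℝ)
    (hsrc : ∀ k i, classSourceSum (ρ i) P (cls k) i ≤ ENNReal.ofReal (Real.exp (k * r i)))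
    (hE : ∀ i, E ≤ E0 (ρ i) W (Q i) - t * r i) :
    PartitionAchieves P W t E cls Q := by
  intro n hn
  -- The constant 8 is 2 · |ι| times two equal class bounds, with |ι| = 2. The second term pays for
  -- replacing k by t n in either class.
  refine ⟨_, hn.tendsto_slack (Real.log 8) (|r 0| + |r 1|), fun k dec hdec => ?_⟩
  refine (ensembleErrorProb_le P W (cls k) Q dec hdec hρ).trans ?_
  set b : ℝ := -(n k : ℝ) * E + (|r 0| + |r 1|) * |(k : ℝ) - t * n k| with hb
  have hterm : ∀ i, classSourceSum (ρ i) P (cls k) i * chanSum (ρ i) W (Q i) ^ n k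
      ≤ ENNReal.ofReal (Real.exp b) := by
    intro i
    rw [chanSum_eq_ofReal_exp W (Q i) (hρ i).1, ofReal_exp_pow]
    refine (mul_le_mul_left (hsrc k i) _).trans ?_
    rw [ofReal_exp_mul]
    refine ENNReal.ofReal_le_ofReal (Real.exp_le_exp.2 ?_)
    have h1 : (n k : ℝ) * E ≤ n k * (E0 (ρ i) W (Q i) - t * r i) :=
      mul_le_mul_of_nonneg_left (hE i) (Nat.cast_nonneg _)
    have h2 : ((k : ℝ) - t * n k) * r i ≤ (|r 0| + |r 1|) * |(k : ℝ) - t * n k| := by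
      refine (le_abs_self _).trans ?_
      rw [abs_mul, mul_comm]
      refine mul_le_mul_of_nonneg_right ?_ (abs_nonneg _)
      fin_cases i
      · exact le_add_of_nonneg_right (abs_nonneg _)
      · exact le_add_of_nonneg_left (abs_nonneg _)
    rw [hb]
    linarith
  calc _ ≤ 2 * (Fintype.card (Fin 2) : ℝ≥0∞) * ∑ _i : Fin 2, ENNReal.ofReal (Real.exp b) :=
        mul_le_mul_right (Finset.sum_le_sum fun i _ => hterm i) _
    _ = ENNReal.ofReal 8 * ENNReal.ofReal (Real.exp b) := by
        rw [Fin.sum_univ_two, ← two_mul, ← mul_assoc]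
        congr 1
        norm_num
    _ = _ := by
        rw [← Real.exp_log (show (0 : ℝ) < 8 by norm_num), ofReal_exp_mul, Real.log_exp]
        congr 2
        rw [hb]
        ring

theorem PartitionAchieves.isAchievable {ι : Type*} {cls : (k : ℕ) → (Fin k → V) → ι}
    {Q : ι → PMF X} (h : PartitionAchieves P W t E cls Q) : IsAchievable P W t E := by
  intro n hn
  obtain ⟨δ, hδ, hle⟩ := h n hn
  choose dec hdec using fun (k : ℕ) (c : Codebook V X k (n k)) => exists_isMAPDecoder P W c
  choose c hc using fun k => exists_errorProb_le_ensembleErrorProb P W (cls k) Q (dec k)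
  exact ⟨c, fun k => dec k (c k), δ, fun k => hdec k _, hδ,
    fun k => (hc k).trans (hle k (dec k) (hdec k))⟩

end Achievability

/-! ### The maximization over the concave hull and its first-order condition. -/

section Optimization

variable {V : Type*} [Fintype V] (P : PMF V)

theorem continuousOn_Es : ContinuousOn (fun ρ => Es ρ P) (Set.Icc 0 1) := fun ρ hρ =>
  (hasDerivAt_Es P (by linarith [hρ.1])).continuousAt.continuousWithinAt

theorem convexComb_mem {a b l : ℝ} (ha : a ∈ Set.Icc (0 : ℝ) 1) (hb : b ∈ Set.Icc (0 : ℝ) 1)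
    (hl : l ∈ Set.Icc (0 : ℝ) 1) : l * a + (1 - l) * b ∈ Set.Icc (0 : ℝ) 1 :=
  convex_Icc (0 : ℝ) 1 ha hb hl.1 (by linarith [hl.2]) (by ring)

/-- Maximizing over both points and the weight at once, on a compact cube, merges the supremum in
the hull with the maximum over ρ. -/
theorem exists_max_timeSharing {m : ℝ → ℝ} (hm : ContinuousOn m (Set.Icc 0 1)) (t : ℝ) :
    ∃ a ∈ Set.Icc (0 : ℝ) 1, ∃ b ∈ Set.Icc (0 : ℝ) 1, ∃ l ∈ Set.Icc (0 : ℝ) 1,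
      ∀ a' ∈ Set.Icc (0 : ℝ) 1, ∀ b' ∈ Set.Icc (0 : ℝ) 1, ∀ l' ∈ Set.Icc (0 : ℝ) 1,
        l' * m a' + (1 - l') * m b' - t * Es (l' * a' + (1 - l') * b') P
          ≤ l * m a + (1 - l) * m b - t * Es (l * a + (1 - l) * b) P := by
  set K : Set (ℝ × ℝ × ℝ) := Set.Icc (0 : ℝ) 1 ×ˢ Set.Icc (0 : ℝ) 1 ×ˢ Set.Icc (0 : ℝ) 1
  have hK : IsCompact K := isCompact_Icc.prod (isCompact_Icc.prod isCompact_Icc)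
  have hKne : K.Nonempty := ⟨(0, 0, 0), by simp [K]⟩
  have hcont : ContinuousOn (fun z : ℝ × ℝ × ℝ => z.2.2 * m z.1 + (1 - z.2.2) * m z.2.1 -
      t * Es (z.2.2 * z.1 + (1 - z.2.2) * z.2.1) P) K := by
    have h1 : ContinuousOn (fun z : ℝ × ℝ × ℝ => m z.1) K :=
      hm.comp continuousOn_fst fun z hz => hz.1
    have h2 : ContinuousOn (fun z : ℝ × ℝ × ℝ => m z.2.1) K :=
      hm.comp (by fun_prop) fun z hz => hz.2.1
    have h3 : ContinuousOn
        (fun z : ℝ × ℝ × ℝ => Es (z.2.2 * z.1 + (1 - z.2.2) * z.2.1) P) K :=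
      (continuousOn_Es P).comp (f := fun z : ℝ × ℝ × ℝ => z.2.2 * z.1 + (1 - z.2.2) * z.2.1)
        (by fun_prop) fun z hz => convexComb_mem hz.1 hz.2.1 hz.2.2
    have hl : ContinuousOn (fun z : ℝ × ℝ × ℝ => z.2.2) K := by fun_prop
    exact ((hl.mul h1).add ((continuousOn_const.sub hl).mul h2)).sub (continuousOn_const.mul h3)
  obtain ⟨⟨a, b, l⟩, hz, hmax⟩ := hK.exists_isMaxOn hKne hcont
  exact ⟨a, hz.1, b, hz.2.1, l, hz.2.2, fun a' ha b' hb l' hl =>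
    hmax (show (a', b', l') ∈ K from ⟨ha, hb, hl⟩)⟩

/-- At an optimal time-sharing point, both components lie on the tangent of `t * E_s` shifted
by the optimal value. -/
theorem exists_tangent_of_max {m : ℝ → ℝ} {t a b l : ℝ} (ha : a ∈ Set.Icc (0 : ℝ) 1)
    (hb : b ∈ Set.Icc (0 : ℝ) 1) (hl : l ∈ Set.Icc (0 : ℝ) 1)
    (hmax : ∀ l' ∈ Set.Icc (0 : ℝ) 1,
      l' * m a + (1 - l') * m b - t * Es (l' * a + (1 - l') * b) P
        ≤ l * m a + (1 - l) * m b - t * Es (l * a + (1 - l) * b) P) :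
    ∃ σ ρ₁ ρ₂ : ℝ, 0 ≤ ρ₁ ∧ ρ₁ ≤ σ ∧ σ ≤ ρ₂ ∧ ρ₂ ≤ 1 ∧
      ∀ ρ, ρ = ρ₁ ∨ ρ = ρ₂ →
        l * m a + (1 - l) * m b - t * Es (l * a + (1 - l) * b) P
          = m ρ - t * (((1 + ρ) * Es σ P + (σ - ρ) * tiltedLogMean P σ) / (1 + σ)) := by
  have hself : ∀ σ, 0 ≤ σ →
      ((1 + σ) * Es σ P + (σ - σ) * tiltedLogMean P σ) / (1 + σ) = Es σ P := by
    intro σ hσ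
    have : 1 + σ ≠ 0 := by linarith
    field_simp
    ring
  rcases hl.1.eq_or_lt with rfl | hl0
  -- At an endpoint weight stationarity is not available, but a single point carries the optimum: σ,
  -- ρ₁, ρ₂ coincide and the tangent is evaluated at its contact point.
  · refine ⟨b, b, b, hb.1, le_rfl, le_rfl, hb.2, ?_⟩
    rintro ρ (rfl | rfl) <;> rw [hself _ hb.1] <;> simp
  rcases hl.2.eq_or_lt with rfl | hl1
  · refine ⟨a, a, a, ha.1, le_rfl, le_rfl, ha.2, ?_⟩
    rintro ρ (rfl | rfl) <;> rw [hself _ ha.1] <;> simp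
  set σ := l * a + (1 - l) * b with hσ
  have hσ0 : 0 ≤ σ := (convexComb_mem ha hb hl).1
  have h1σ : 0 < 1 + σ := by linarith
  set ℓ := tiltedLogMean P σ
  set d := (Es σ P - ℓ) / (1 + σ) with hd
  have hchord : ∀ ρ, ((1 + ρ) * Es σ P + (σ - ρ) * ℓ) / (1 + σ) = Es σ P + (ρ - σ) * d := by
    intro ρ
    rw [hd]
    field_simp
    ring
  have hderiv : HasDerivAt
      (fun x : ℝ => x * m a + (1 - x) * m b - t * Es (x * a + (1 - x) * b) P)
      (m a - m b - t * (d * (a - b))) l := by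
    have hin : HasDerivAt (fun x : ℝ => x * a + (1 - x) * b) (a - b) l := by
      refine (((hasDerivAt_id l).mul_const a).add
        (((hasDerivAt_id l).const_sub 1).mul_const b)).congr_deriv ?_
      ring
    have hmm : HasDerivAt (fun x : ℝ => x * m a + (1 - x) * m b) (m a - m b) l := by
      refine (((hasDerivAt_id l).mul_const (m a)).add
        (((hasDerivAt_id l).const_sub 1).mul_const (m b))).congr_deriv ?_
      ring
    have hEs : HasDerivAt (fun r => Es r P) d (l * a + (1 - l) * b) :=
      hasDerivAt_Es P (by linarith)
    have hcomp : HasDerivAt (fun x : ℝ => Es (x * a + (1 - x) * b) P) (d * (a - b)) l :=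
      HasDerivAt.comp (h₂ := fun r => Es r P) l hEs hin
    exact hmm.sub (hcomp.const_mul t)
  have hloc : IsLocalMax
      (fun x : ℝ => x * m a + (1 - x) * m b - t * Es (x * a + (1 - x) * b) P) l := by
    filter_upwards [Icc_mem_nhds hl0 hl1] with x hx
    exact hmax x hx
  have hzero := hloc.hasDerivAt_eq_zero hderiv
  -- Stationarity gives m a - m b = t d (a - b); combine with a - σ = (1 - l)(a - b), and below with
  -- b - σ = -l (a - b).
  have hfa : l * m a + (1 - l) * m b - t * Es σ P = m a - t * (Es σ P + (a - σ) * d) := by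
    rw [hσ]
    linear_combination (-(1 - l)) * hzero
  have hfb : l * m a + (1 - l) * m b - t * Es σ P = m b - t * (Es σ P + (b - σ) * d) := by
    rw [hσ]
    linear_combination l * hzero
  rcases le_total a b with hab | hab
  · refine ⟨σ, a, b, ha.1, by rw [hσ]; nlinarith, by rw [hσ]; nlinarith, hb.2, ?_⟩
    rintro ρ (rfl | rfl)
    · rw [hchord]; exact hfa
    · rw [hchord]; exact hfb
  · refine ⟨σ, b, a, hb.1, by rw [hσ]; nlinarith, by rw [hσ]; nlinarith, ha.2, ?_⟩
    rintro ρ (rfl | rfl)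
    · rw [hchord]; exact hfb
    · rw [hchord]; exact hfa

/-- Joint maximality also bounds above the sets whose `sSup` defines `barE0`, so these suprema are
genuine. -/
theorem isGreatest_barE0_sub {X Y : Type*} (W : X → PMF Y) (𝒬 : Set (PMF X)) {t a b l : ℝ}
    (ha : a ∈ Set.Icc (0 : ℝ) 1) (hb : b ∈ Set.Icc (0 : ℝ) 1) (hl : l ∈ Set.Icc (0 : ℝ) 1)
    (hmax : ∀ a' ∈ Set.Icc (0 : ℝ) 1, ∀ b' ∈ Set.Icc (0 : ℝ) 1, ∀ l' ∈ Set.Icc (0 : ℝ) 1,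
        l' * E0Set a' W 𝒬 + (1 - l') * E0Set b' W 𝒬 - t * Es (l' * a' + (1 - l') * b') P
          ≤ l * E0Set a W 𝒬 + (1 - l) * E0Set b W 𝒬 - t * Es (l * a + (1 - l) * b) P) :
    IsGreatest ((fun ρ : ℝ => barE0 ρ W 𝒬 - t * Es ρ P) '' Set.Icc (0 : ℝ) 1)
      (l * E0Set a W 𝒬 + (1 - l) * E0Set b W 𝒬 - t * Es (l * a + (1 - l) * b) P) := by
  have hub : ∀ ρ, ∀ z ∈ {z | ∃ ρ₁ ∈ Set.Icc (0 : ℝ) 1, ∃ ρ₂ ∈ Set.Icc (0 : ℝ) 1,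
      ∃ l ∈ Set.Icc (0 : ℝ) 1, l * ρ₁ + (1 - l) * ρ₂ = ρ ∧
        z = l * E0Set ρ₁ W 𝒬 + (1 - l) * E0Set ρ₂ W 𝒬},
      z ≤ l * E0Set a W 𝒬 + (1 - l) * E0Set b W 𝒬 - t * Es (l * a + (1 - l) * b) P +
        t * Es ρ P := by
    rintro ρ z ⟨a', ha', b', hb', l', hl', rfl, rfl⟩
    linarith [hmax a' ha' b' hb' l' hl']
  have hle : ∀ ρ ∈ Set.Icc (0 : ℝ) 1, barE0 ρ W 𝒬 - t * Es ρ P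
      ≤ l * E0Set a W 𝒬 + (1 - l) * E0Set b W 𝒬 - t * Es (l * a + (1 - l) * b) P := by
    intro ρ hρ
    rw [sub_le_iff_le_add]
    exact csSup_le ⟨_, ρ, hρ, ρ, hρ, 1, by simp, by ring, rfl⟩ (hub ρ)
  refine ⟨⟨_, convexComb_mem ha hb hl, le_antisymm (hle _ (convexComb_mem ha hb hl)) ?_⟩, ?_⟩
  · exact sub_le_sub_right (le_csSup ⟨_, hub _⟩ ⟨a, ha, b, hb, l, hl, rfl, rfl⟩) _
  · rintro _ ⟨ρ, hρ, rfl⟩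
    exact hle ρ hρ

end Optimization

end JSCC

theorem theorem2 {V X Y : Type*} [Fintype V] [Countable X] [Countable Y]
    (P : PMF V) (W : X → PMF Y) (t : ℝ) (Q Q' : PMF X) :
    ∃ E : ℝ,
      IsGreatest
        ((fun ρ : ℝ => JSCC.barE0 ρ W {Q, Q'} - t * JSCC.Es ρ P) '' Set.Icc (0 : ℝ) 1) E ∧
      JSCC.IsAchievable P W t E ∧
      ∃ γ ∈ Set.Icc (0 : ℝ) 1,
        ∃ Q₁ ∈ ({Q, Q'} : Set (PMF X)), ∃ Q₂ ∈ ({Q, Q'} : Set (PMF X)),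
          JSCC.PartitionAchieves P W t E (JSCC.thresholdClass P γ) ![Q₁, Q₂] := by
  obtain ⟨a, ha, b, hb, l, hl, hmax⟩ := JSCC.exists_max_timeSharing P
    ((JSCC.continuousOn_E0Set_pair W Q Q').mono Set.Icc_subset_Ici_self) t
  obtain ⟨σ, ρ₁, ρ₂, h0, h1, h2, h3, htan⟩ := JSCC.exists_tangent_of_max P
    (m := fun ρ => JSCC.E0Set ρ W {Q, Q'}) ha hb hl (hmax a ha b hb)
  obtain ⟨Q₁, hQ₁, hE₁⟩ := JSCC.exists_E0_eq_E0Set_pair W Q ρ₁ Q'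
  obtain ⟨Q₂, hQ₂, hE₂⟩ := JSCC.exists_E0_eq_E0Set_pair W Q ρ₂ Q'
  -- The threshold is γ = e^ℓ with ℓ the tilted mean at σ; the less likely messages get the smaller
  -- parameter ρ₁, and each class gets the distribution that maximizes E₀ at its parameter.
  have hach : JSCC.PartitionAchieves P W t _
      (JSCC.thresholdClass P (Real.exp (JSCC.tiltedLogMean P σ))) ![Q₁, Q₂] :=
    JSCC.partitionAchieves_of_classSourceSum_le (ρ := ![ρ₁, ρ₂])
      (Fin.forall_fin_two.2
        ⟨⟨h0, (h1.trans h2).trans h3⟩, ⟨(h0.trans h1).trans h2, h3⟩⟩)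
      (fun i => ((1 + ![ρ₁, ρ₂] i) * JSCC.Es σ P +
        (σ - ![ρ₁, ρ₂] i) * JSCC.tiltedLogMean P σ) / (1 + σ))
      (fun k => Fin.forall_fin_two.2
        ⟨JSCC.classSourceSum_threshold_zero_le P (show -1 < ρ₁ by linarith) h1 _,
          JSCC.classSourceSum_threshold_one_le P (by linarith) h2 _⟩)
      (Fin.forall_fin_two.2
        ⟨((htan ρ₁ (Or.inl rfl)).trans (by simp [hE₁])).le,
          ((htan ρ₂ (Or.inr rfl)).trans (by simp [hE₂])).le⟩)
  exact ⟨_, JSCC.isGreatest_barE0_sub P W {Q, Q'} ha hb hl hmax, hach.isAchievable,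
    Real.exp (JSCC.tiltedLogMean P σ),
    ⟨(Real.exp_pos _).le, Real.exp_le_one_iff.2 (JSCC.tiltedLogMean_nonpos P σ)⟩,
    Q₁, hQ₁, Q₂, hQ₂, hach⟩
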